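/- Let $\Phi:\mathbb R^n\to\mathbb R^m$ and $D:\mathbb R^p\to\mathbb R^n$ be linear maps between Euclidean spaces, with adjoints $\Phi^*$ and $D^*$, and let $x_0\in\mathbb R^n$. Let $\mathbb R^p=\bigoplus_{g=1}^q V_g$ be a decomposition into mutually orthogonal subspaces (groups), and write $u=\sum_{g}u_g$ with $u_g\in V_g$ for $u\in\mathbb R^p$. Put $$\|u\|_{\ell_1/\ell_2}=\sum_{g=1}^q\|u_g\|,\qquad \|u\|_{\ell_\infty/\ell_2}=\max_{1\le g\le q}\|u_g\|$$ (both are $0$ if $q=0$). Consider the problem $$(P)\qquad \min_{x\in\mathbb R^n}\ \|D^*x\|_{\ell_1/\ell_2}\quad\text{subject to}\quad \Phi x=\Phi x_0,$$ and let $\Psi(x)=\|D^*x\|_{\ell_1/\ell_2}$ if $\Phi x=\Phi x_0$ and $\Psi(x)=+\infty$ otherwise. A solution of $(P)$ is a global minimizer of $\Psi$. The point $x_0$ is a strong solution of $(P)$ if there are $\kappa>0$ and $\delta>0$ such that $\Psi(x)\ge\Psi(x_0)+\frac{\kappa}{2}\|x-x_0\|^2$ for all $x$ with $\|x-x_0\|\le\delta$.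 Let $I=\{g:(D^*x_0)_g\ne0\}$, $T=\bigoplus_{g\in I}V_g$, $S=T^\perp$, $e=\sum_{g\in I}(D^*x_0)_g/\|(D^*x_0)_g\|$. For a subspace $W\subset\mathbb R^p$ let $D_W=DP_W$, where $P_W$ is the orthogonal projection onto $W$, and $D_W^*=(D_W)^*$. Let $$\mathcal E=\{w\in\mathbb R^n:\ D_T^*w\in\operatorname{span}\{(D_T^*x_0)_g: g\in I\}\}.$$ Let $M$ be any matrix such that the columns of $M^*$ form a basis of $\operatorname{Ker}\Phi\cap\mathcal E$, let $A^\dagger$ denote the Moore–Penrose inverse of $A$, and define the Strong Source Coefficient $$\zeta(e)=\min_{u\in\operatorname{Ker}(MD_S)}\big\|(MD_S)^\dagger MD_Te-u\big\|_{\ell_\infty/\ell_2}.$$ **Theorem.** The minimum defining $\zeta(e)$ is attained, and the following assertions are equivalent: (i) $x_0$ is the unique solution of $(P)$; (ii) $x_0$ is a strong solution of $(P)$; (iii) $x_0$ is a solution of $(P)$, the Strong Restricted Injectivity $\operatorname{Ker}\Phi\cap\mathcal E\cap\operatorname{Ker}D_S^*=\{0\}$ holds, and $\zeta(e)<1$.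 -/

import Mathlib

open scoped InnerProductSpace

noncomputable section

namespace GroupSparsity

/-! ### Moore-Penrose inverse -/

/-- The Moore-Penrose inverse `A†` of a linear map between finite-dimensional Euclidean spaces:
project orthogonally onto the range of `A`, then apply the inverse of the bijection
`(Ker A)ᗮ → Im A` induced by `A`. The two lemmas below are the usual characterization of `A†`. -/
def pinv {E F : Type*} [NormedAddCommGroup E] [InnerProductSpace ℝ E] [FiniteDimensional ℝ E]
    [NormedAddCommGroup F] [InnerProductSpace ℝ F] [FiniteDimensional ℝ F]
    (A : E →ₗ[ℝ] F) : F →ₗ[ℝ] E :=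
  (LinearMap.ker A)ᗮ.subtype ∘ₗ
    ((A.kerComplementEquivRange (LinearMap.ker A).isCompl_orthogonal.symm).symm : LinearMap.range A →ₗ[ℝ] (LinearMap.ker A)ᗮ) ∘ₗ
    ((LinearMap.range A).orthogonalProjectionOnto : F →ₗ[ℝ] LinearMap.range A)

/-- `A A†` is the orthogonal projection onto `Im A`. -/
theorem apply_pinv {E F : Type*} [NormedAddCommGroup E] [InnerProductSpace ℝ E]
    [FiniteDimensional ℝ E] [NormedAddCommGroup F] [InnerProductSpace ℝ F]
    [FiniteDimensional ℝ F] (A : E →ₗ[ℝ] F) (y : F) :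
    A (pinv A y) = (LinearMap.range A).starProjection y := by
  set e := A.kerComplementEquivRange (LinearMap.ker A).isCompl_orthogonal.symm with he
  have h : ∀ z, A (e.symm z : E) = (z : F) := fun z => by
    conv_rhs => rw [← e.apply_symm_apply z]
    rfl
  exact h _

/-- `A† A` is the orthogonal projection onto `(Ker A)ᗮ`. -/
theorem pinv_apply {E F : Type*} [NormedAddCommGroup E] [InnerProductSpace ℝ E]
    [FiniteDimensional ℝ E] [NormedAddCommGroup F] [InnerProductSpace ℝ F]
    [FiniteDimensional ℝ F] (A : E →ₗ[ℝ] F) (x : E) :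
    pinv A (A x) = (LinearMap.ker A)ᗮ.starProjection x := by
  have h1 : A (pinv A (A x)) = A x := by
    rw [apply_pinv]
    exact Submodule.starProjection_eq_self_iff.mpr ⟨x, rfl⟩
  have h2 : pinv A (A x) ∈ (LinearMap.ker A)ᗮ := Subtype.coe_prop _
  refine (Submodule.eq_starProjection_of_mem_of_inner_eq_zero h2 fun w hw => ?_).symm
  refine (Submodule.mem_orthogonal _ _).mp hw _ ?_
  rw [LinearMap.mem_ker, map_sub, h1, sub_self]

/-! ### Solutions of an optimization problem with an extended-real-valued objective -/

/-- `x₀` is a solution (global minimizer). -/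
def IsSolution {E : Type*} (φ : E → EReal) (x₀ : E) : Prop :=
  ∀ x, φ x₀ ≤ φ x

/-- `x₀` is the unique solution: it is a solution, and there is no other one. -/
def IsUniqueSolution {E : Type*} (φ : E → EReal) (x₀ : E) : Prop :=
  IsSolution φ x₀ ∧ ∀ x, IsSolution φ x → x = x₀

/-- `x₀` is a strong solution: local quadratic growth
`φ x ≥ φ x₀ + (κ / 2) ‖x - x₀‖ ^ 2` on a closed ball around `x₀`. -/
def IsStrongSolution {E : Type*} [NormedAddCommGroup E] (φ : E → EReal) (x₀ : E) : Prop :=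
  ∃ κ > (0 : ℝ), ∃ δ > (0 : ℝ), ∀ x ∈ Metric.closedBall x₀ δ,
    φ x₀ + ((κ / 2 * ‖x - x₀‖ ^ 2 : ℝ) : EReal) ≤ φ x

/-! ### Groups, the `ℓ₁/ℓ₂` norm and the `ℓ_∞/ℓ₂` norm -/

/-- The subspaces `V g` form an orthogonal direct sum decomposition of `ℝᵖ` into groups. -/
structure IsGroupDecomposition {p q : ℕ}
    (V : Fin q → Submodule ℝ (EuclideanSpace ℝ (Fin p))) : Prop where
  isInternal : DirectSum.IsInternal V
  orthogonal : OrthogonalFamily ℝ (fun g => V g) fun g => (V g).subtypeₗᵢ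

/-- The component `u_g` of `u` in the group `V g`. As the groups are orthogonal, it is the
orthogonal projection of `u` onto `V g`. -/
def groupPart {p q : ℕ} (V : Fin q → Submodule ℝ (EuclideanSpace ℝ (Fin p))) (g : Fin q)
    (u : EuclideanSpace ℝ (Fin p)) : EuclideanSpace ℝ (Fin p) :=
  (V g).starProjection u

theorem IsGroupDecomposition.sum_groupPart {p q : ℕ}
    {V : Fin q → Submodule ℝ (EuclideanSpace ℝ (Fin p))} (hV : IsGroupDecomposition V)
    (u : EuclideanSpace ℝ (Fin p)) : ∑ g, groupPart V g u = u :=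
  hV.orthogonal.sum_projection_of_mem_iSup u
    (by rw [hV.isInternal.submodule_iSup_eq_top]; exact Submodule.mem_top)

/-- `‖u‖_{ℓ₁/ℓ₂} = ∑_g ‖u_g‖`. -/
def l12Norm {p q : ℕ} (V : Fin q → Submodule ℝ (EuclideanSpace ℝ (Fin p)))
    (u : EuclideanSpace ℝ (Fin p)) : ℝ :=
  ∑ g, ‖groupPart V g u‖

/-- `‖u‖_{ℓ_∞/ℓ₂} = max_g ‖u_g‖` (and `0` if there is no group, i.e. on the zero space). -/
def linf2Norm {p q : ℕ} (V : Fin q → Submodule ℝ (EuclideanSpace ℝ (Fin p)))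
    (u : EuclideanSpace ℝ (Fin p)) : ℝ :=
  ⨆ g, ‖groupPart V g u‖

/-! ### The analysis group-sparsity problem
`min ‖D^* x‖_{ℓ₁/ℓ₂}` subject to `Φ x = Φ x₀` -/

open Classical in
/-- `Ψ x = ‖D^* x‖_{ℓ₁/ℓ₂}` if `Φ x = Φ x₀`, and `Ψ x = +∞` otherwise. -/
def objective {n m p q : ℕ} (V : Fin q → Submodule ℝ (EuclideanSpace ℝ (Fin p)))
    (Φ : EuclideanSpace ℝ (Fin n) →ₗ[ℝ] EuclideanSpace ℝ (Fin m))
    (D : EuclideanSpace ℝ (Fin p) →ₗ[ℝ] EuclideanSpace ℝ (Fin n))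
    (x₀ x : EuclideanSpace ℝ (Fin n)) : EReal :=
  if Φ x = Φ x₀ then ((l12Norm V (D.adjoint x) : ℝ) : EReal) else ⊤

/-- The set `I` of active groups: those `g` with `(D^* x₀)_g ≠ 0`. -/
def activeGroups {n p q : ℕ} (V : Fin q → Submodule ℝ (EuclideanSpace ℝ (Fin p)))
    (D : EuclideanSpace ℝ (Fin p) →ₗ[ℝ] EuclideanSpace ℝ (Fin n))
    (x₀ : EuclideanSpace ℝ (Fin n)) : Set (Fin q) :=
  {g | groupPart V g (D.adjoint x₀) ≠ 0}

/-- `T = ⨁_{g ∈ I} V g`. -/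
def modelT {n p q : ℕ} (V : Fin q → Submodule ℝ (EuclideanSpace ℝ (Fin p)))
    (D : EuclideanSpace ℝ (Fin p) →ₗ[ℝ] EuclideanSpace ℝ (Fin n))
    (x₀ : EuclideanSpace ℝ (Fin n)) : Submodule ℝ (EuclideanSpace ℝ (Fin p)) :=
  ⨆ g ∈ activeGroups V D x₀, V g

/-- `S = Tᗮ`. -/
def modelS {n p q : ℕ} (V : Fin q → Submodule ℝ (EuclideanSpace ℝ (Fin p)))
    (D : EuclideanSpace ℝ (Fin p) →ₗ[ℝ] EuclideanSpace ℝ (Fin n))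
    (x₀ : EuclideanSpace ℝ (Fin n)) : Submodule ℝ (EuclideanSpace ℝ (Fin p)) :=
  (modelT V D x₀)ᗮ

open Classical in
/-- `e = ∑_{g ∈ I} (D^* x₀)_g / ‖(D^* x₀)_g‖`. -/
def modelVector {n p q : ℕ} (V : Fin q → Submodule ℝ (EuclideanSpace ℝ (Fin p)))
    (D : EuclideanSpace ℝ (Fin p) →ₗ[ℝ] EuclideanSpace ℝ (Fin n))
    (x₀ : EuclideanSpace ℝ (Fin n)) : EuclideanSpace ℝ (Fin p) :=
  ∑ g with g ∈ activeGroups V D x₀,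
    ‖groupPart V g (D.adjoint x₀)‖⁻¹ • groupPart V g (D.adjoint x₀)

/-- `D_W = D P_W`, where `P_W` is the orthogonal projection of `ℝᵖ` onto the subspace `W`. -/
def restrictTo {n p : ℕ} (D : EuclideanSpace ℝ (Fin p) →ₗ[ℝ] EuclideanSpace ℝ (Fin n))
    (W : Submodule ℝ (EuclideanSpace ℝ (Fin p))) :
    EuclideanSpace ℝ (Fin p) →ₗ[ℝ] EuclideanSpace ℝ (Fin n) :=
  D ∘ₗ (W.starProjection : EuclideanSpace ℝ (Fin p) →ₗ[ℝ] EuclideanSpace ℝ (Fin p))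

/-- `D_T`. -/
def DT {n p q : ℕ} (V : Fin q → Submodule ℝ (EuclideanSpace ℝ (Fin p)))
    (D : EuclideanSpace ℝ (Fin p) →ₗ[ℝ] EuclideanSpace ℝ (Fin n))
    (x₀ : EuclideanSpace ℝ (Fin n)) :
    EuclideanSpace ℝ (Fin p) →ₗ[ℝ] EuclideanSpace ℝ (Fin n) :=
  restrictTo D (modelT V D x₀)

/-- `D_S`. -/
def DS {n p q : ℕ} (V : Fin q → Submodule ℝ (EuclideanSpace ℝ (Fin p)))
    (D : EuclideanSpace ℝ (Fin p) →ₗ[ℝ] EuclideanSpace ℝ (Fin n))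
    (x₀ : EuclideanSpace ℝ (Fin n)) :
    EuclideanSpace ℝ (Fin p) →ₗ[ℝ] EuclideanSpace ℝ (Fin n) :=
  restrictTo D (modelS V D x₀)

/-- The subspace `{w | D_T^* w ∈ span {(D_T^* x₀)_g | g ∈ I}}` of `ℝⁿ`. -/
def spaceE {n p q : ℕ} (V : Fin q → Submodule ℝ (EuclideanSpace ℝ (Fin p)))
    (D : EuclideanSpace ℝ (Fin p) →ₗ[ℝ] EuclideanSpace ℝ (Fin n))
    (x₀ : EuclideanSpace ℝ (Fin n)) : Submodule ℝ (EuclideanSpace ℝ (Fin n)) :=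
  (Submodule.span ℝ
    ((fun g => groupPart V g ((DT V D x₀).adjoint x₀)) '' activeGroups V D x₀)).comap
    (DT V D x₀).adjoint

/-- The columns of the matrix of `B` (the images of the standard basis vectors) form a basis of
the subspace `W`: they are linearly independent and span `W`. -/
def IsBasisMatrix {n k : ℕ} (B : EuclideanSpace ℝ (Fin k) →ₗ[ℝ] EuclideanSpace ℝ (Fin n))
    (W : Submodule ℝ (EuclideanSpace ℝ (Fin n))) : Prop :=
  LinearIndependent ℝ (fun i => B (EuclideanSpace.single i 1)) ∧
    Submodule.span ℝ (Set.range fun i => B (EuclideanSpace.single i 1)) = W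

/-- The values `‖(M D_S)† M D_T e - u‖_{ℓ_∞/ℓ₂}`, `u ∈ Ker (M D_S)`, over which the Strong
Source Coefficient is the minimum. -/
def sourceValues {n p q k : ℕ} (V : Fin q → Submodule ℝ (EuclideanSpace ℝ (Fin p)))
    (D : EuclideanSpace ℝ (Fin p) →ₗ[ℝ] EuclideanSpace ℝ (Fin n))
    (M : EuclideanSpace ℝ (Fin n) →ₗ[ℝ] EuclideanSpace ℝ (Fin k))
    (x₀ : EuclideanSpace ℝ (Fin n)) : Set ℝ :=
  (fun u => linf2Norm V
      (pinv (M ∘ₗ DS V D x₀) (M (DT V D x₀ (modelVector V D x₀))) - u)) ''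
    (LinearMap.ker (M ∘ₗ DS V D x₀) : Set (EuclideanSpace ℝ (Fin p)))

/-- The Strong Source Coefficient `ζ(e)`. -/
def strongSourceCoeff {n p q k : ℕ} (V : Fin q → Submodule ℝ (EuclideanSpace ℝ (Fin p)))
    (D : EuclideanSpace ℝ (Fin p) →ₗ[ℝ] EuclideanSpace ℝ (Fin n))
    (M : EuclideanSpace ℝ (Fin n) →ₗ[ℝ] EuclideanSpace ℝ (Fin k))
    (x₀ : EuclideanSpace ℝ (Fin n)) : ℝ :=
  sInf (sourceValues V D M x₀)

end GroupSparsity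

end

/-! Write `f x = ‖D^* x‖_{ℓ₁/ℓ₂}`. Its directional derivative at `x₀` is
`f'(w) = ⟪D_T e, w⟫ + ‖D_S^* w‖_{ℓ₁/ℓ₂}` (`IsGroupDecomposition.sum_normSlope_eq`), and `𝓔` consists of
the directions along which every active group of `D^* x₀` moves on its own line. In such a direction
`f` is affine on a short segment starting at `x₀`; in every other direction the curvature of the Euclidean norm makes `f` grow
quadratically above its linearization. All conditions of the theorem thus amount, for a solution
`x₀`, to `f' > 0` on the nonzero vectors of `Ker Φ ∩ 𝓔`.

* If `x₀` is the unique solution, this positivity holds since `f` is affine on short segments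
  (`IsUniqueSolution.sum_normSlope_pos`).
* The columns of `M^*` parametrize `Ker Φ ∩ 𝓔`, so with `B = M D_S` and `b = M D_T e` positivity reads
  `|⟪b, z⟫| < ‖B^* z‖_{ℓ₁/ℓ₂}` for `z ≠ 0`. By duality between the `ℓ₁/ℓ₂` and `ℓ_∞/ℓ₂` norms this is
  injectivity of `B^*` together with a solution of `B v = b` with `‖v‖_{ℓ_∞/ℓ₂} < 1`; the solutions
  are the vectors `B† b - u` with `u ∈ Ker B`, so such a `v` exists iff `ζ(e) < 1`. Existence of `v`
  comes from compactness and the Hahn-Banach theorem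
  (`IsGroupDecomposition.exists_preimage_linf2Norm_lt_one`).
* Given positivity, `f'` plus the curvature term is positive on the unit sphere of `Ker Φ`, hence
  bounded below there, which yields quadratic growth (`IsSolution.isStrongSolution`).
* A strong solution is the unique one by convexity of `f`. -/

namespace GroupSparsity

open Filter Topology

/-! ### First- and second-order behaviour of the norm of an inner product space -/

section Norm

variable {F : Type*} [NormedAddCommGroup F] [InnerProductSpace ℝ F]

open Classical in
/-- The one-sided directional derivative of the norm at `y` in the direction `v`. -/
noncomputable def normSlope (y v : F) : ℝ :=
  if y = 0 then ‖v‖ else ⟪‖y‖⁻¹ • y, v⟫_ℝ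

open Classical in
/-- The squared norm of the component of `v` orthogonal to `y`, which governs the second-order
growth of the norm at `y`. At the kink `y = 0` it is set to `0`: there the slope already accounts
for all of the growth. -/
noncomputable def normCurv (y v : F) : ℝ :=
  if y = 0 then 0 else ‖v - ⟪‖y‖⁻¹ • y, v⟫_ℝ • (‖y‖⁻¹ • y)‖ ^ 2

theorem continuous_normSlope (y : F) : Continuous (normSlope y) := by
  unfold normSlope
  split_ifs <;> fun_prop

theorem continuous_normCurv (y : F) : Continuous (normCurv y) := by
  unfold normCurv
  split_ifs <;> fun_prop

theorem normCurv_nonneg (y v : F) : 0 ≤ normCurv y v := by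
  unfold normCurv
  split_ifs <;> positivity

theorem normSlope_smul (y v : F) {t : ℝ} (ht : 0 ≤ t) :
    normSlope y (t • v) = t * normSlope y v := by
  unfold normSlope
  split_ifs
  · rw [norm_smul, Real.norm_of_nonneg ht]
  · rw [inner_smul_right]

theorem normCurv_smul (y v : F) (t : ℝ) : normCurv y (t • v) = t ^ 2 * normCurv y v := by
  unfold normCurv
  split_ifs
  · simp
  · rw [inner_smul_right, mul_smul, ← smul_sub, norm_smul, mul_pow, Real.norm_eq_abs, sq_abs]

theorem mem_span_of_normCurv_eq_zero {y v : F} (hy : y ≠ 0) (h : normCurv y v = 0) :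
    v ∈ Submodule.span ℝ {y} := by
  rw [normCurv, if_neg hy, sq_eq_zero_iff, norm_eq_zero, sub_eq_zero] at h
  rw [h, smul_smul]
  exact Submodule.smul_mem _ _ (Submodule.mem_span_singleton_self y)

theorem norm_add_ge (y : F) {v : F} (hv : ‖v‖ ≤ 1) :
    ‖y‖ + normSlope y v + normCurv y v / (2 * ‖y‖ + 2) ≤ ‖y + v‖ := by
  unfold normSlope normCurv
  split_ifs with h
  · simp [h]
  · have hy : 0 < ‖y‖ := norm_pos_iff.mpr h
    set a := ⟪‖y‖⁻¹ • y, v⟫_ℝ with ha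
    have hinner : ⟪y, v⟫_ℝ = ‖y‖ * a := by
      rw [ha, real_inner_smul_left]
      field_simp
    have hunit : ‖‖y‖⁻¹ • y‖ = 1 := by
      rw [norm_smul, norm_inv, norm_norm, inv_mul_cancel₀ hy.ne']
    have hperp : ‖v - a • (‖y‖⁻¹ • y)‖ ^ 2 = ‖v‖ ^ 2 - a ^ 2 := by
      rw [norm_sub_sq_real, inner_smul_right, real_inner_comm, ← ha, norm_smul, hunit,
        Real.norm_eq_abs, mul_one, sq_abs]
      ring
    have hsq : ‖y + v‖ ^ 2 = (‖y‖ + a) ^ 2 + (‖v‖ ^ 2 - a ^ 2) := by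
      rw [norm_add_sq_real, hinner]
      ring
    have haa : |a| ≤ ‖v‖ := by
      have := abs_real_inner_le_norm (‖y‖⁻¹ • y) v
      rwa [hunit, one_mul] at this
    have hB : 0 ≤ ‖v‖ ^ 2 - a ^ 2 := by rw [← hperp]; positivity
    have hA : ‖y‖ + a ≤ ‖y + v‖ :=
      abs_le_of_sq_le_sq' (by rw [hsq]; linarith) (norm_nonneg _) |>.2
    have hK : ‖y + v‖ + (‖y‖ + a) ≤ 2 * ‖y‖ + 2 := by
      have := norm_add_le y v
      have := le_abs_self a
      linarith
    rw [hperp, ← le_sub_iff_add_le', div_le_iff₀ (by positivity)]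
    -- the difference of squares `‖y + v‖² - (‖y‖ + a)²` factors
    calc ‖v‖ ^ 2 - a ^ 2 = (‖y + v‖ - (‖y‖ + a)) * (‖y + v‖ + (‖y‖ + a)) := by
          linear_combination -hsq
      _ ≤ _ := mul_le_mul_of_nonneg_left hK (sub_nonneg.mpr hA)

theorem exists_norm_add_smul_le (y v : F) :
    ∃ C, ∀ t : ℝ, 0 < t → ‖y + t • v‖ ≤ ‖y‖ + t * normSlope y v + C * t ^ 2 := by
  unfold normSlope
  split_ifs with h
  · refine ⟨0, fun t ht => ?_⟩
    simp [h, norm_smul, abs_of_pos ht]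
  · have hy : 0 < ‖y‖ := norm_pos_iff.mpr h
    refine ⟨‖v‖ ^ 2 / (2 * ‖y‖), fun t _ => ?_⟩
    have hsq : ‖y + t • v‖ ^ 2 = ‖y‖ ^ 2 + 2 * t * ⟪y, v⟫_ℝ + t ^ 2 * ‖v‖ ^ 2 := by
      rw [norm_add_sq_real, inner_smul_right, norm_smul, mul_pow, Real.norm_eq_abs, sq_abs]
      ring
    have key : 2 * ‖y‖ * ‖y + t • v‖ ≤ 2 * ‖y‖ ^ 2 + 2 * t * ⟪y, v⟫_ℝ + t ^ 2 * ‖v‖ ^ 2 := by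
      linarith [sq_nonneg (‖y + t • v‖ - ‖y‖)]
    rw [real_inner_smul_left]
    refine le_of_mul_le_mul_left (key.trans_eq ?_) (show 0 < 2 * ‖y‖ by positivity)
    field_simp

/-- Along its own line `ℝ y` (along every line if `y = 0`) the norm is affine near `y`, to the
right. -/
theorem eventually_norm_add_smul_eq {y v : F} (h : y ≠ 0 → v ∈ Submodule.span ℝ {y}) :
    ∀ᶠ t : ℝ in 𝓝[>] 0, ‖y + t • v‖ = ‖y‖ + t * normSlope y v := by
  unfold normSlope
  split_ifs with hy
  · filter_upwards [self_mem_nhdsWithin] with t ht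
    simp [hy, norm_smul, abs_of_pos (Set.mem_Ioi.mp ht)]
  · obtain ⟨c, rfl⟩ := Submodule.mem_span_singleton.mp (h hy)
    have hy' : 0 < ‖y‖ := norm_pos_iff.mpr hy
    have hc : ∀ᶠ t : ℝ in 𝓝 0, 0 < 1 + t * c :=
      (by fun_prop : Continuous fun t : ℝ => 1 + t * c).continuousAt.eventually
        (lt_mem_nhds (by simp))
    filter_upwards [hc.filter_mono nhdsWithin_le_nhds] with t ht
    have : y + t • c • y = (1 + t * c) • y := by rw [add_smul, one_smul, mul_smul]
    rw [this, norm_smul, Real.norm_of_nonneg ht.le, inner_smul_right, real_inner_smul_left,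
      real_inner_self_eq_norm_sq]
    field_simp

end Norm

/-! ### Group components -/

section Groups

variable {p q : ℕ} {V : Fin q → Submodule ℝ (EuclideanSpace ℝ (Fin p))}

theorem groupPart_add (g : Fin q) (u v : EuclideanSpace ℝ (Fin p)) :
    groupPart V g (u + v) = groupPart V g u + groupPart V g v := map_add _ _ _

theorem groupPart_sub (g : Fin q) (u v : EuclideanSpace ℝ (Fin p)) :
    groupPart V g (u - v) = groupPart V g u - groupPart V g v := map_sub _ _ _

theorem groupPart_smul (g : Fin q) (t : ℝ) (u : EuclideanSpace ℝ (Fin p)) :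
    groupPart V g (t • u) = t • groupPart V g u := map_smul _ _ _

theorem continuous_groupPart (g : Fin q) : Continuous (groupPart V g) :=
  (V g).starProjection.continuous

theorem norm_groupPart_le (g : Fin q) (u : EuclideanSpace ℝ (Fin p)) : ‖groupPart V g u‖ ≤ ‖u‖ :=
  (V g).norm_starProjection_apply_le u

theorem groupPart_groupPart (g : Fin q) (u : EuclideanSpace ℝ (Fin p)) :
    groupPart V g (groupPart V g u) = groupPart V g u :=
  Submodule.starProjection_eq_self_iff.mpr (Submodule.starProjection_apply_mem _ _)

theorem inner_groupPart_left (g : Fin q) (u v : EuclideanSpace ℝ (Fin p)) :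
    ⟪groupPart V g u, v⟫_ℝ = ⟪u, groupPart V g v⟫_ℝ :=
  Submodule.inner_starProjection_left_eq_right _ _ _

theorem IsGroupDecomposition.groupPart_groupPart_of_ne (hV : IsGroupDecomposition V) {g h : Fin q}
    (hgh : g ≠ h) (u : EuclideanSpace ℝ (Fin p)) : groupPart V g (groupPart V h u) = 0 := by
  refine (Submodule.starProjection_apply_eq_zero_iff _).mpr
    ((Submodule.mem_orthogonal _ _).mpr fun x hx => ?_)
  exact hV.orthogonal hgh ⟨x, hx⟩ ⟨groupPart V h u, Submodule.starProjection_apply_mem _ _⟩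

theorem IsGroupDecomposition.inner_eq_sum (hV : IsGroupDecomposition V)
    (u v : EuclideanSpace ℝ (Fin p)) :
    ⟪u, v⟫_ℝ = ∑ g, ⟪groupPart V g u, groupPart V g v⟫_ℝ := by
  conv_lhs => rw [← hV.sum_groupPart v, inner_sum]
  refine Finset.sum_congr rfl fun g _ => ?_
  rw [inner_groupPart_left, groupPart_groupPart]

theorem linf2Norm_eq_norm (u : EuclideanSpace ℝ (Fin p)) :
    linf2Norm V u = ‖fun g => groupPart V g u‖ := by
  refine le_antisymm (Real.iSup_le (fun g => ?_) (norm_nonneg _)) ?_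
  · exact norm_le_pi_norm (fun g => groupPart V g u) g
  · refine (pi_norm_le_iff_of_nonneg (Real.iSup_nonneg fun g => norm_nonneg _)).mpr fun g => ?_
    exact le_ciSup (f := fun g => ‖groupPart V g u‖) (Set.finite_range _).bddAbove g

theorem continuous_linf2Norm : Continuous (linf2Norm V) := by
  rw [funext linf2Norm_eq_norm]
  exact (continuous_pi continuous_groupPart).norm

theorem norm_groupPart_le_linf2Norm (g : Fin q) (u : EuclideanSpace ℝ (Fin p)) :
    ‖groupPart V g u‖ ≤ linf2Norm V u := by
  rw [linf2Norm_eq_norm]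
  exact norm_le_pi_norm (fun g => groupPart V g u) g

theorem IsGroupDecomposition.norm_le_mul_linf2Norm (hV : IsGroupDecomposition V)
    (u : EuclideanSpace ℝ (Fin p)) : ‖u‖ ≤ q * linf2Norm V u := by
  calc ‖u‖ = ‖∑ g, groupPart V g u‖ := by rw [hV.sum_groupPart]
    _ ≤ ∑ g, ‖groupPart V g u‖ := norm_sum_le _ _
    _ ≤ ∑ _g : Fin q, linf2Norm V u :=
        Finset.sum_le_sum fun g _ => norm_groupPart_le_linf2Norm g u
    _ = q * linf2Norm V u := by simp

theorem l12Norm_nonneg (u : EuclideanSpace ℝ (Fin p)) : 0 ≤ l12Norm V u :=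
  Finset.sum_nonneg fun _ _ => norm_nonneg _

theorem continuous_l12Norm : Continuous (l12Norm V) :=
  continuous_finsetSum _ fun g _ => (continuous_groupPart g).norm

theorem l12Norm_add_le (u v : EuclideanSpace ℝ (Fin p)) :
    l12Norm V (u + v) ≤ l12Norm V u + l12Norm V v := by
  unfold l12Norm
  rw [← Finset.sum_add_distrib]
  exact Finset.sum_le_sum fun g _ => by rw [groupPart_add]; exact norm_add_le _ _

theorem l12Norm_smul (t : ℝ) (u : EuclideanSpace ℝ (Fin p)) :
    l12Norm V (t • u) = |t| * l12Norm V u := by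
  simp only [l12Norm, groupPart_smul, norm_smul, Finset.mul_sum, Real.norm_eq_abs]

theorem l12Norm_zero : l12Norm V 0 = 0 := by
  simp [l12Norm, groupPart]

theorem l12Norm_neg (u : EuclideanSpace ℝ (Fin p)) : l12Norm V (-u) = l12Norm V u := by
  rw [← neg_one_smul ℝ, l12Norm_smul, abs_neg, abs_one, one_mul]

theorem IsGroupDecomposition.l12Norm_pos (hV : IsGroupDecomposition V)
    {u : EuclideanSpace ℝ (Fin p)} (hu : u ≠ 0) : 0 < l12Norm V u := by
  refine (norm_pos_iff.mpr hu).trans_le ?_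
  conv_lhs => rw [← hV.sum_groupPart u]
  exact norm_sum_le _ _

theorem IsGroupDecomposition.l12Norm_groupPart (hV : IsGroupDecomposition V) (g : Fin q)
    (u : EuclideanSpace ℝ (Fin p)) : l12Norm V (groupPart V g u) = ‖groupPart V g u‖ := by
  unfold l12Norm
  rw [Finset.sum_eq_single g, groupPart_groupPart]
  · intro h _ hne
    rw [hV.groupPart_groupPart_of_ne hne, norm_zero]
  · simp

theorem IsGroupDecomposition.inner_le_linf2Norm_mul_l12Norm (hV : IsGroupDecomposition V)
    (u v : EuclideanSpace ℝ (Fin p)) : ⟪u, v⟫_ℝ ≤ linf2Norm V u * l12Norm V v := by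
  rw [hV.inner_eq_sum, l12Norm, Finset.mul_sum]
  refine Finset.sum_le_sum fun g _ => (real_inner_le_norm _ _).trans ?_
  exact mul_le_mul_of_nonneg_right (norm_groupPart_le_linf2Norm g u) (norm_nonneg _)

/-- The `ℓ_∞/ℓ₂` norm is dominated by the dual norm of the `ℓ₁/ℓ₂` norm. -/
theorem IsGroupDecomposition.linf2Norm_le_of_inner_le (hV : IsGroupDecomposition V)
    {u : EuclideanSpace ℝ (Fin p)} {r : ℝ} (hr : 0 ≤ r)
    (h : ∀ v, ⟪u, v⟫_ℝ ≤ r * l12Norm V v) : linf2Norm V u ≤ r := by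
  refine Real.iSup_le (fun g => ?_) hr
  have h1 := h (groupPart V g u)
  rw [hV.l12Norm_groupPart, ← groupPart_groupPart, ← inner_groupPart_left, groupPart_groupPart,
    real_inner_self_eq_norm_sq, sq] at h1
  rcases (norm_nonneg (groupPart V g u)).eq_or_lt with h0 | h0
  · rwa [← h0]
  · exact le_of_mul_le_mul_right h1 h0

end Groups

/-! ### Duality between the two group norms -/

section Duality

variable {p q k : ℕ} {V : Fin q → Submodule ℝ (EuclideanSpace ℝ (Fin p))}

/-- A strict bound `⟪b, z⟫ < ‖B^* z‖_{ℓ₁/ℓ₂}` is uniform by compactness of the sphere, and then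
the Hahn-Banach theorem extends the functional `B^* z ↦ ⟪b, z⟫` to all of `ℝᵖ`. -/
theorem IsGroupDecomposition.exists_preimage_linf2Norm_lt_one (hV : IsGroupDecomposition V)
    (B : EuclideanSpace ℝ (Fin p) →ₗ[ℝ] EuclideanSpace ℝ (Fin k))
    (hB : Function.Injective B.adjoint) (b : EuclideanSpace ℝ (Fin k))
    (h : ∀ z, z ≠ 0 → ⟪b, z⟫_ℝ < l12Norm V (B.adjoint z)) :
    ∃ v, B v = b ∧ linf2Norm V v < 1 := by
  have hpos : ∀ z, z ≠ 0 → 0 < l12Norm V (B.adjoint z) := fun z hz =>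
    hV.l12Norm_pos ((map_ne_zero_iff _ hB).mpr hz)
  have hcont : Continuous fun z => l12Norm V (B.adjoint z) :=
    continuous_l12Norm.comp (LinearMap.continuous_of_finiteDimensional _)
  have hsph : ∀ z ∈ Metric.sphere (0 : EuclideanSpace ℝ (Fin k)) 1, z ≠ 0 := by
    rintro z hz rfl
    simp at hz
  obtain ⟨μ, hμ, hle⟩ := (isCompact_sphere (0 : EuclideanSpace ℝ (Fin k)) 1).exists_forall_le'
    (f := fun z => 1 - ⟪b, z⟫_ℝ / l12Norm V (B.adjoint z)) (a := 0)
    (continuousOn_const.sub (ContinuousOn.div (by fun_prop) hcont.continuousOn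
      fun z hz => (hpos z (hsph z hz)).ne'))
    (fun z hz => sub_pos.mpr ((div_lt_one (hpos z (hsph z hz))).mpr (h z (hsph z hz))))
  -- `1 - μ` may be negative, when `k = 0`
  set r := max (1 - μ) 0 with hr
  have hr0 : 0 ≤ r := le_max_right _ _
  have hbound : ∀ z, ⟪b, z⟫_ℝ ≤ r * l12Norm V (B.adjoint z) := by
    intro z
    rcases eq_or_ne z 0 with rfl | hz
    · rw [inner_zero_right]
      exact mul_nonneg hr0 (l12Norm_nonneg _)
    · have hzn : 0 < ‖z‖ := norm_pos_iff.mpr hz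
      have h1 := hle (‖z‖⁻¹ • z) (by simp [norm_smul, hzn.ne'])
      rw [inner_smul_right, map_smul, l12Norm_smul, abs_of_pos (inv_pos.mpr hzn),
        mul_div_mul_left _ _ (inv_pos.mpr hzn).ne', le_sub_comm, div_le_iff₀ (hpos z hz)] at h1
      exact h1.trans (mul_le_mul_of_nonneg_right (le_max_left _ _) (l12Norm_nonneg _))
  let eq := LinearEquiv.ofInjective B.adjoint hB
  let φ : EuclideanSpace ℝ (Fin p) →ₗ.[ℝ] ℝ :=
    ⟨LinearMap.range B.adjoint, (innerₗ _ b) ∘ₗ (eq.symm : _ →ₗ[ℝ] EuclideanSpace ℝ (Fin k))⟩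
  obtain ⟨ψ, hψ, hψle⟩ := exists_extension_of_le_sublinear φ (fun u => r * l12Norm V u)
    (fun c hc u => by rw [l12Norm_smul, abs_of_pos hc]; ring)
    (fun u v => by rw [← mul_add]; exact mul_le_mul_of_nonneg_left (l12Norm_add_le u v) hr0)
    (fun u => by
      have h1 := hbound (eq.symm u)
      rwa [show B.adjoint (eq.symm u) = u from
        congrArg Subtype.val (eq.apply_symm_apply u)] at h1)
  refine ⟨(InnerProductSpace.toDual ℝ _).symm (LinearMap.toContinuousLinearMap ψ), ?_, ?_⟩
  · refine ext_inner_right ℝ fun z => ?_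
    rw [← LinearMap.adjoint_inner_right, InnerProductSpace.toDual_symm_apply]
    refine (hψ ⟨B.adjoint z, z, rfl⟩).trans ?_
    change ⟪b, eq.symm (eq z)⟫_ℝ = _
    rw [eq.symm_apply_apply]
  · refine (hV.linf2Norm_le_of_inner_le hr0 fun u => ?_).trans_lt
      (max_lt (sub_lt_self 1 hμ) one_pos)
    rw [InnerProductSpace.toDual_symm_apply]
    exact hψle u

end Duality

/-! ### The model subspaces and the operators `D_T`, `D_S` -/

section Model

variable {n m p q k : ℕ} {V : Fin q → Submodule ℝ (EuclideanSpace ℝ (Fin p))}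
  {Φ : EuclideanSpace ℝ (Fin n) →ₗ[ℝ] EuclideanSpace ℝ (Fin m)}
  {D : EuclideanSpace ℝ (Fin p) →ₗ[ℝ] EuclideanSpace ℝ (Fin n)}
  {x₀ : EuclideanSpace ℝ (Fin n)}
  {M : EuclideanSpace ℝ (Fin n) →ₗ[ℝ] EuclideanSpace ℝ (Fin k)}

theorem restrictTo_adjoint_apply (W : Submodule ℝ (EuclideanSpace ℝ (Fin p)))
    (w : EuclideanSpace ℝ (Fin n)) :
    (restrictTo D W).adjoint w = W.starProjection (D.adjoint w) := by
  refine ext_inner_left ℝ fun u => ?_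
  rw [LinearMap.adjoint_inner_right, ← Submodule.inner_starProjection_left_eq_right,
    LinearMap.adjoint_inner_right]
  rfl

theorem groupPart_starProjection_modelT_of_mem {g : Fin q} (hg : g ∈ activeGroups V D x₀)
    (u : EuclideanSpace ℝ (Fin p)) :
    groupPart V g ((modelT V D x₀).starProjection u) = groupPart V g u := by
  have hle : V g ≤ modelT V D x₀ := le_iSup₂_of_le g hg le_rfl
  have := Submodule.starProjection_comp_starProjection_of_le hle
  exact congrArg (fun f => f u) this

theorem IsGroupDecomposition.groupPart_starProjection_modelT_of_notMem
    (hV : IsGroupDecomposition V) {g : Fin q} (hg : g ∉ activeGroups V D x₀)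
    (u : EuclideanSpace ℝ (Fin p)) :
    groupPart V g ((modelT V D x₀).starProjection u) = 0 := by
  have hle : modelT V D x₀ ≤ (V g)ᗮ := by
    refine iSup₂_le fun h hh x hx => (Submodule.mem_orthogonal _ _).mpr fun y hy => ?_
    have hne : g ≠ h := by rintro rfl; exact hg hh
    exact hV.orthogonal hne ⟨y, hy⟩ ⟨x, hx⟩
  exact (Submodule.starProjection_apply_eq_zero_iff _).mpr
    (hle (Submodule.starProjection_apply_mem _ _))

theorem groupPart_starProjection_modelS (g : Fin q) (u : EuclideanSpace ℝ (Fin p)) :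
    groupPart V g ((modelS V D x₀).starProjection u) =
      groupPart V g u - groupPart V g ((modelT V D x₀).starProjection u) := by
  rw [← groupPart_sub]
  congr 1
  rw [modelS, eq_sub_iff_add_eq, add_comm]
  exact Submodule.starProjection_add_starProjection_orthogonal _

theorem IsGroupDecomposition.mem_spaceE_iff (hV : IsGroupDecomposition V)
    {w : EuclideanSpace ℝ (Fin n)} :
    w ∈ spaceE V D x₀ ↔ ∀ g, groupPart V g (D.adjoint x₀) ≠ 0 →
      groupPart V g (D.adjoint w) ∈ Submodule.span ℝ {groupPart V g (D.adjoint x₀)} := by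
  rw [spaceE, Submodule.mem_comap, DT, restrictTo_adjoint_apply, restrictTo_adjoint_apply]
  constructor
  · intro h g hg
    rw [← groupPart_starProjection_modelT_of_mem (x₀ := x₀) (D := D) hg (D.adjoint w)]
    have h1 := Submodule.mem_map_of_mem
      (f := ((V g).starProjection : EuclideanSpace ℝ (Fin p) →ₗ[ℝ] EuclideanSpace ℝ (Fin p))) h
    rw [Submodule.map_span] at h1
    refine Submodule.span_le.mpr ?_ h1
    rintro _ ⟨_, ⟨i, hi, rfl⟩, rfl⟩
    change groupPart V g (groupPart V i _) ∈ Submodule.span ℝ _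
    rw [groupPart_starProjection_modelT_of_mem hi]
    rcases eq_or_ne g i with rfl | hne
    · rw [groupPart_groupPart]
      exact Submodule.mem_span_singleton_self _
    · rw [hV.groupPart_groupPart_of_ne hne]
      exact zero_mem _
  · intro h
    rw [← hV.sum_groupPart ((modelT V D x₀).starProjection (D.adjoint w))]
    refine Submodule.sum_mem _ fun g _ => ?_
    by_cases hg : g ∈ activeGroups V D x₀
    · rw [groupPart_starProjection_modelT_of_mem hg]
      refine Submodule.span_mono ?_ (h g hg)
      rw [Set.singleton_subset_iff]
      exact ⟨g, hg, groupPart_starProjection_modelT_of_mem hg _⟩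
    · rw [hV.groupPart_starProjection_modelT_of_notMem hg]
      exact zero_mem _

/-- The directional derivative of `x ↦ ‖D^* x‖_{ℓ₁/ℓ₂}` at `x₀` in the direction `w`, in terms of
the model vector and of `D_T`, `D_S`. -/
theorem IsGroupDecomposition.sum_normSlope_eq (hV : IsGroupDecomposition V)
    (w : EuclideanSpace ℝ (Fin n)) :
    ∑ g, normSlope (groupPart V g (D.adjoint x₀)) (groupPart V g (D.adjoint w)) =
      ⟪DT V D x₀ (modelVector V D x₀), w⟫_ℝ + l12Norm V ((DS V D x₀).adjoint w) := by
  rw [← LinearMap.adjoint_inner_right, DT, DS, restrictTo_adjoint_apply, restrictTo_adjoint_apply,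
    modelVector, sum_inner, Finset.sum_filter, l12Norm, ← Finset.sum_add_distrib]
  refine Finset.sum_congr rfl fun g _ => ?_
  rw [groupPart_starProjection_modelS]
  by_cases hg : g ∈ activeGroups V D x₀
  · rw [if_pos hg, groupPart_starProjection_modelT_of_mem hg, sub_self, norm_zero, add_zero,
      normSlope, if_neg hg, real_inner_smul_left, real_inner_smul_left, inner_groupPart_left,
      inner_groupPart_left, groupPart_groupPart, groupPart_starProjection_modelT_of_mem hg]
  · have h0 : groupPart V g (D.adjoint x₀) = 0 := not_not.mp hg
    rw [if_neg hg, hV.groupPart_starProjection_modelT_of_notMem hg, sub_zero, zero_add,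
      normSlope, if_pos h0]

/-! ### The matrix `M` and the Strong Source Coefficient -/

theorem IsBasisMatrix.injective {B : EuclideanSpace ℝ (Fin k) →ₗ[ℝ] EuclideanSpace ℝ (Fin n)}
    {W : Submodule ℝ (EuclideanSpace ℝ (Fin n))} (h : IsBasisMatrix B W) :
    Function.Injective B := by
  refine (injective_iff_map_eq_zero B).mpr fun z hz => ?_
  have hsum := (EuclideanSpace.basisFun (Fin k) ℝ).sum_repr z
  rw [← hsum, map_sum] at hz
  simp only [map_smul, EuclideanSpace.basisFun_apply] at hz
  have h0 := Fintype.linearIndependent_iff.mp h.1 _ hz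
  rw [← hsum]
  simp [h0]

theorem IsBasisMatrix.range_eq {B : EuclideanSpace ℝ (Fin k) →ₗ[ℝ] EuclideanSpace ℝ (Fin n)}
    {W : Submodule ℝ (EuclideanSpace ℝ (Fin n))} (h : IsBasisMatrix B W) :
    LinearMap.range B = W := by
  have hspan := (EuclideanSpace.basisFun (Fin k) ℝ).toBasis.span_eq
  rw [← h.2, LinearMap.range_eq_map, ← hspan, Submodule.map_span, ← Set.range_comp]
  congr 2
  ext i
  simp

theorem IsGroupDecomposition.isLeast_strongSourceCoeff (hV : IsGroupDecomposition V) :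
    IsLeast (sourceValues V D M x₀) (strongSourceCoeff V D M x₀) := by
  set K := LinearMap.ker (M ∘ₗ DS V D x₀)
  set a := pinv (M ∘ₗ DS V D x₀) (M (DT V D x₀ (modelVector V D x₀))) with ha
  have hcont : Continuous fun u : K => linf2Norm V (a - u) :=
    continuous_linf2Norm.comp (by fun_prop)
  have hcoer : Tendsto (fun u : K => linf2Norm V (a - u)) (cocompact K) atTop := by
    have h1 : Tendsto (fun u : K => ‖u‖ - ‖a‖) (cocompact K) atTop :=
      tendsto_atTop_add_const_right _ _ (tendsto_norm_cocompact_atTop (E := K))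
    have h2 := h1.atTop_div_const (show (0 : ℝ) < q + 1 by positivity)
    refine tendsto_atTop_mono (fun u => ?_) h2
    rw [div_le_iff₀ (by positivity)]
    have h3 := hV.norm_le_mul_linf2Norm (a - u)
    have h4 : 0 ≤ linf2Norm V (a - u) := by rw [linf2Norm_eq_norm]; positivity
    have h5 : ‖(u : EuclideanSpace ℝ (Fin p))‖ - ‖a‖ ≤ ‖a - u‖ := by
      rw [norm_sub_rev]; exact norm_sub_norm_le _ _
    rw [Submodule.coe_norm]
    linarith
  obtain ⟨u, hu⟩ := hcont.exists_forall_le hcoer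
  have hleast : IsLeast (sourceValues V D M x₀) (linf2Norm V (a - u)) := by
    refine ⟨⟨u, u.2, rfl⟩, ?_⟩
    rintro _ ⟨v, hv, rfl⟩
    exact hu ⟨v, hv⟩
  rwa [strongSourceCoeff, hleast.csInf_eq]

theorem adjoint_comp_DS_apply (z : EuclideanSpace ℝ (Fin k)) :
    (M ∘ₗ DS V D x₀).adjoint z = (DS V D x₀).adjoint (M.adjoint z) := by
  rw [LinearMap.adjoint_comp]; rfl

theorem injective_adjoint_comp_DS {W : Submodule ℝ (EuclideanSpace ℝ (Fin n))}
    (hM : IsBasisMatrix M.adjoint W) (hW : W ⊓ LinearMap.ker (DS V D x₀).adjoint = ⊥) :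
    Function.Injective (M ∘ₗ DS V D x₀).adjoint := by
  refine (injective_iff_map_eq_zero _).mpr fun z hz => ?_
  rw [adjoint_comp_DS_apply] at hz
  have hmem : M.adjoint z ∈ W ⊓ LinearMap.ker (DS V D x₀).adjoint :=
    ⟨hM.range_eq ▸ LinearMap.mem_range_self _ z, hz⟩
  rw [hW, Submodule.mem_bot] at hmem
  exact hM.injective (hmem.trans (map_zero _).symm)

/-- The primal side of the duality: if the objective is strictly increasing to first order in
every direction of `W`, then `M D_S v = M D_T e` has a solution of `ℓ_∞/ℓ₂` norm less than one. -/
theorem IsGroupDecomposition.strongSourceCoeff_lt_one (hV : IsGroupDecomposition V)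
    {W : Submodule ℝ (EuclideanSpace ℝ (Fin n))} (hM : IsBasisMatrix M.adjoint W)
    (hW : W ⊓ LinearMap.ker (DS V D x₀).adjoint = ⊥)
    (hslope : ∀ w ∈ W, w ≠ 0 →
      0 < ⟪DT V D x₀ (modelVector V D x₀), w⟫_ℝ + l12Norm V ((DS V D x₀).adjoint w)) :
    strongSourceCoeff V D M x₀ < 1 := by
  obtain ⟨v, hv, hv1⟩ := hV.exists_preimage_linf2Norm_lt_one (M ∘ₗ DS V D x₀)
    (injective_adjoint_comp_DS hM hW) (M (DT V D x₀ (modelVector V D x₀))) fun z hz => by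
      have h1 := hslope (M.adjoint (-z)) (hM.range_eq ▸ LinearMap.mem_range_self _ _)
        ((map_ne_zero_iff _ hM.injective).mpr (neg_ne_zero.mpr hz))
      rw [LinearMap.adjoint_inner_right, inner_neg_right, ← adjoint_comp_DS_apply, map_neg,
        l12Norm_neg] at h1
      linarith
  refine (hV.isLeast_strongSourceCoeff.2
    ⟨pinv (M ∘ₗ DS V D x₀) (M (DT V D x₀ (modelVector V D x₀))) - v, ?_, ?_⟩).trans_lt hv1
  · refine LinearMap.mem_ker.mpr ?_
    rw [map_sub, hv, apply_pinv, sub_eq_zero]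
    exact Submodule.starProjection_eq_self_iff.mpr ⟨v, hv⟩
  · exact congrArg (linf2Norm V) (sub_sub_cancel _ _)

/-- The dual certificate side: a solution of `M D_S v = M D_T e` of `ℓ_∞/ℓ₂` norm less than one
makes the objective strictly increasing to first order in the directions of `W`. -/
theorem IsGroupDecomposition.slope_pos_of_strongSourceCoeff_lt_one (hV : IsGroupDecomposition V)
    {W : Submodule ℝ (EuclideanSpace ℝ (Fin n))} (hM : IsBasisMatrix M.adjoint W)
    (hW : W ⊓ LinearMap.ker (DS V D x₀).adjoint = ⊥) (hζ : strongSourceCoeff V D M x₀ < 1)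
    {w : EuclideanSpace ℝ (Fin n)} (hw : w ∈ W) (hw0 : w ≠ 0) :
    0 < ⟪DT V D x₀ (modelVector V D x₀), w⟫_ℝ + l12Norm V ((DS V D x₀).adjoint w) := by
  have hinj := injective_adjoint_comp_DS hM hW
  obtain ⟨u, hu, huζ⟩ := (hV.isLeast_strongSourceCoeff (D := D) (M := M) (x₀ := x₀)).1
  set b := M (DT V D x₀ (modelVector V D x₀)) with hb
  dsimp only at huζ
  set v := pinv (M ∘ₗ DS V D x₀) b - u with hv
  -- `M D_S` is onto since its adjoint is injective, so that `v` is an exact preimage of `b`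
  have hrange : LinearMap.range (M ∘ₗ DS V D x₀) = ⊤ := by
    rw [← Submodule.orthogonal_eq_bot_iff, LinearMap.orthogonal_range]
    exact LinearMap.ker_eq_bot.mpr hinj
  have hBv : (M ∘ₗ DS V D x₀) v = b := by
    rw [hv, map_sub, apply_pinv, LinearMap.mem_ker.mp hu, sub_zero]
    exact Submodule.starProjection_eq_self_iff.mpr (hrange ▸ Submodule.mem_top)
  obtain ⟨z, rfl⟩ : w ∈ LinearMap.range M.adjoint := hM.range_eq.symm ▸ hw
  have hz : z ≠ 0 := by rintro rfl; exact hw0 (map_zero _)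
  have hpos : 0 < l12Norm V ((M ∘ₗ DS V D x₀).adjoint z) :=
    hV.l12Norm_pos ((map_ne_zero_iff _ hinj).mpr hz)
  have h1 := hV.inner_le_linf2Norm_mul_l12Norm v ((M ∘ₗ DS V D x₀).adjoint (-z))
  rw [LinearMap.adjoint_inner_right, hBv, inner_neg_right, map_neg, l12Norm_neg, huζ] at h1
  rw [LinearMap.adjoint_inner_right, ← hb, ← adjoint_comp_DS_apply]
  linarith [mul_lt_mul_of_pos_right hζ hpos]

/-! ### Growth of the objective -/

theorem objective_self : objective V Φ D x₀ x₀ = (l12Norm V (D.adjoint x₀) : ℝ) :=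
  if_pos rfl

theorem objective_add {w : EuclideanSpace ℝ (Fin n)} (hw : w ∈ LinearMap.ker Φ) :
    objective V Φ D x₀ (x₀ + w) = (l12Norm V (D.adjoint x₀ + D.adjoint w) : ℝ) := by
  rw [objective, if_pos (by rw [map_add, LinearMap.mem_ker.mp hw, add_zero]), map_add]

theorem isSolution_iff : IsSolution (objective V Φ D x₀) x₀ ↔
    ∀ w ∈ LinearMap.ker Φ, l12Norm V (D.adjoint x₀) ≤ l12Norm V (D.adjoint x₀ + D.adjoint w) := by
  constructor
  · intro h w hw
    have := h (x₀ + w)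
    rwa [objective_self, objective_add hw, EReal.coe_le_coe_iff] at this
  · intro h x
    by_cases hx : Φ x = Φ x₀
    · have hw : x - x₀ ∈ LinearMap.ker Φ := by rw [LinearMap.mem_ker, map_sub, hx, sub_self]
      rw [← add_sub_cancel x₀ x, objective_self, objective_add hw, EReal.coe_le_coe_iff]
      exact h _ hw
    · rw [show objective V Φ D x₀ x = ⊤ from if_neg hx]
      exact le_top

/-- At a solution no feasible direction has negative slope. -/
theorem IsSolution.sum_normSlope_nonneg (h : IsSolution (objective V Φ D x₀) x₀)
    {w : EuclideanSpace ℝ (Fin n)} (hw : w ∈ LinearMap.ker Φ) :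
    0 ≤ ∑ g, normSlope (groupPart V g (D.adjoint x₀)) (groupPart V g (D.adjoint w)) := by
  choose C hC using fun g =>
    exists_norm_add_smul_le (groupPart V g (D.adjoint x₀)) (groupPart V g (D.adjoint w))
  set s := ∑ g, normSlope (groupPart V g (D.adjoint x₀)) (groupPart V g (D.adjoint w))
  have hlin : ∀ t : ℝ, 0 < t → 0 ≤ s + (∑ g, C g) * t := by
    intro t ht
    have h1 := isSolution_iff.mp h (t • w) (Submodule.smul_mem _ t hw)
    have h2 : l12Norm V (D.adjoint x₀ + D.adjoint (t • w)) ≤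
        l12Norm V (D.adjoint x₀) + t * s + (∑ g, C g) * t ^ 2 := by
      simp only [l12Norm, s, Finset.mul_sum, Finset.sum_mul, ← Finset.sum_add_distrib]
      refine Finset.sum_le_sum fun g _ => ?_
      rw [map_smul, groupPart_add, groupPart_smul]
      exact hC g t ht
    refine nonneg_of_mul_nonneg_right (a := t) ?_ ht
    linarith
  have hlim : Tendsto (fun t : ℝ => s + (∑ g, C g) * t) (𝓝[>] 0) (𝓝 (s + (∑ g, C g) * 0)) :=
    (by fun_prop : Continuous fun t : ℝ => s + (∑ g, C g) * t).continuousAt.tendsto.mono_left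
      nhdsWithin_le_nhds
  rw [mul_zero, add_zero] at hlim
  exact ge_of_tendsto hlim (by filter_upwards [self_mem_nhdsWithin] with t ht using hlin t ht)

/-- On `Ker Φ ∩ 𝓔` the objective is affine to the right of `x₀`, so that a zero slope would produce
further solutions. -/
theorem IsUniqueSolution.sum_normSlope_pos (hV : IsGroupDecomposition V)
    (h : IsUniqueSolution (objective V Φ D x₀) x₀) {w : EuclideanSpace ℝ (Fin n)}
    (hw : w ∈ LinearMap.ker Φ ⊓ spaceE V D x₀) (hw0 : w ≠ 0) :
    0 < ∑ g, normSlope (groupPart V g (D.adjoint x₀)) (groupPart V g (D.adjoint w)) := by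
  have hev := eventually_all.mpr fun g =>
    eventually_norm_add_smul_eq (hV.mem_spaceE_iff.mp hw.2 g)
  obtain ⟨t, ht, ht0 : 0 < t⟩ := (hev.and self_mem_nhdsWithin).exists
  by_contra! hle
  have heq : l12Norm V (D.adjoint x₀ + D.adjoint (t • w)) = l12Norm V (D.adjoint x₀) +
      t * ∑ g, normSlope (groupPart V g (D.adjoint x₀)) (groupPart V g (D.adjoint w)) := by
    simp only [l12Norm, Finset.mul_sum, ← Finset.sum_add_distrib]
    refine Finset.sum_congr rfl fun g _ => ?_
    rw [map_smul, groupPart_add, groupPart_smul]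
    exact ht g
  have hsol : IsSolution (objective V Φ D x₀) (x₀ + t • w) := fun x => by
    refine le_trans ?_ (h.1 x)
    rw [objective_self, objective_add (Submodule.smul_mem _ t hw.1), EReal.coe_le_coe_iff, heq]
    linarith [mul_nonpos_of_nonneg_of_nonpos ht0.le hle]
  have h0 : t • w = 0 := by simpa using h.2 _ hsol
  exact hw0 ((smul_eq_zero.mp h0).resolve_left ht0.ne')

/-- Quadratic growth follows by compactness of the unit sphere of `Ker Φ`: there the slope is
nonnegative, and where it vanishes the direction lies outside `𝓔`, so that the curvature is
positive. -/
theorem IsSolution.isStrongSolution (hV : IsGroupDecomposition V)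
    (h : IsSolution (objective V Φ D x₀) x₀)
    (hslope : ∀ w ∈ LinearMap.ker Φ ⊓ spaceE V D x₀, w ≠ 0 →
      0 < ∑ g, normSlope (groupPart V g (D.adjoint x₀)) (groupPart V g (D.adjoint w))) :
    IsStrongSolution (objective V Φ D x₀) x₀ := by
  set y := fun g => groupPart V g (D.adjoint x₀) with hy
  set v := fun g (w : EuclideanSpace ℝ (Fin n)) => groupPart V g (D.adjoint w) with hv
  set s := fun w : EuclideanSpace ℝ (Fin n) => ∑ g, normSlope (y g) (v g w) with hs
  set c := fun w : EuclideanSpace ℝ (Fin n) =>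
    ∑ g, normCurv (y g) (v g w) / (2 * ‖y g‖ + 2) with hc
  have hvcont : ∀ g, Continuous (v g) := fun g =>
    (continuous_groupPart g).comp (LinearMap.continuous_of_finiteDimensional _)
  have hvsmul : ∀ g (t : ℝ) w, v g (t • w) = t • v g w := fun g t w => by
    simp only [hv, map_smul, groupPart_smul]
  have hscont : Continuous s :=
    continuous_finsetSum _ fun g _ => (continuous_normSlope _).comp (hvcont g)
  have hccont : Continuous c := continuous_finsetSum _ fun g _ =>
    ((continuous_normCurv _).comp (hvcont g)).div_const _
  have hterm : ∀ g w, 0 ≤ normCurv (y g) (v g w) / (2 * ‖y g‖ + 2) := fun g w =>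
    div_nonneg (normCurv_nonneg _ _) (by positivity)
  have hc0 : ∀ w, 0 ≤ c w := fun w => Finset.sum_nonneg fun g _ => hterm g w
  have hpos : ∀ w ∈ LinearMap.ker Φ, w ≠ 0 → 0 < s w + c w := by
    intro w hw hw0
    have hs0 : 0 ≤ s w := h.sum_normSlope_nonneg hw
    by_contra! hle
    have hcz : c w = 0 := le_antisymm (by linarith) (hc0 w)
    refine (hslope w ⟨hw, hV.mem_spaceE_iff.mpr fun g hg => ?_⟩ hw0).not_ge (by
      change s w ≤ 0
      linarith)
    have hz := (Finset.sum_eq_zero_iff_of_nonneg fun g _ => hterm g w).mp hcz g (Finset.mem_univ g)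
    exact mem_span_of_normCurv_eq_zero hg
      ((div_eq_zero_iff.mp hz).resolve_right (by positivity))
  have hcomp : IsCompact (Metric.sphere (0 : EuclideanSpace ℝ (Fin n)) 1 ∩ LinearMap.ker Φ) :=
    (isCompact_sphere _ _).inter_right (Submodule.closed_of_finiteDimensional _)
  obtain ⟨μ, hμ, hμle⟩ := hcomp.exists_forall_le' (hscont.add hccont).continuousOn (a := 0)
    fun w hw => hpos w hw.2 (by rintro rfl; simpa using hw.1)
  -- on this radius every group component of `D^* w` has norm at most one
  obtain ⟨L, hL, hLle⟩ := (LinearMap.toContinuousLinearMap D.adjoint).bound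
  refine ⟨2 * μ, by positivity, min 1 L⁻¹, by positivity, fun x hx => ?_⟩
  by_cases hxf : Φ x = Φ x₀
  swap
  · rw [show objective V Φ D x₀ x = ⊤ from if_neg hxf]
    exact le_top
  obtain ⟨w, rfl⟩ : ∃ w, x = x₀ + w := ⟨x - x₀, by abel⟩
  have hw : w ∈ LinearMap.ker Φ := by
    rw [map_add, add_eq_left] at hxf
    exact hxf
  rw [Metric.mem_closedBall, dist_eq_norm, add_sub_cancel_left, le_min_iff] at hx
  rw [objective_self, objective_add hw, add_sub_cancel_left, ← EReal.coe_add,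
    EReal.coe_le_coe_iff]
  have hvle : ∀ g, ‖v g w‖ ≤ 1 := fun g => by
    refine ((norm_groupPart_le g _).trans (hLle w)).trans ?_
    calc L * ‖w‖ ≤ L * L⁻¹ := mul_le_mul_of_nonneg_left hx.2 hL.le
      _ = 1 := mul_inv_cancel₀ hL.ne'
  have hexp : l12Norm V (D.adjoint x₀) + s w + c w ≤
      l12Norm V (D.adjoint x₀ + D.adjoint w) := by
    simp only [l12Norm, hs, hc, ← Finset.sum_add_distrib]
    refine Finset.sum_le_sum fun g _ => ?_
    rw [groupPart_add]
    exact norm_add_ge _ (hvle g)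
  suffices μ * ‖w‖ ^ 2 ≤ s w + c w by
    rw [mul_div_cancel_left₀ _ (two_ne_zero' ℝ)]
    linarith
  rcases eq_or_ne w 0 with rfl | hw0
  · have h1 : 0 ≤ s 0 := h.sum_normSlope_nonneg (zero_mem _)
    simpa using add_nonneg h1 (hc0 0)
  have hwn : 0 < ‖w‖ := norm_pos_iff.mpr hw0
  set z := ‖w‖⁻¹ • w with hz
  have hzw : w = ‖w‖ • z := by rw [hz, smul_smul, mul_inv_cancel₀ hwn.ne', one_smul]
  have hzk : z ∈ LinearMap.ker Φ := Submodule.smul_mem _ _ hw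
  have hzs : 0 ≤ s z := h.sum_normSlope_nonneg hzk
  have hsz : s w = ‖w‖ * s z := by
    simp only [hs, Finset.mul_sum]
    refine Finset.sum_congr rfl fun g _ => ?_
    rw [← normSlope_smul _ _ hwn.le, ← hvsmul, ← hzw]
  have hcz : c w = ‖w‖ ^ 2 * c z := by
    simp only [hc, Finset.mul_sum]
    refine Finset.sum_congr rfl fun g _ => ?_
    rw [← mul_div_assoc, ← normCurv_smul, ← hvsmul, ← hzw]
  have hμz : μ ≤ s z + c z := hμle z ⟨by simp [hz, norm_smul, hwn.ne'], hzk⟩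
  calc μ * ‖w‖ ^ 2 ≤ (s z + c z) * ‖w‖ ^ 2 := mul_le_mul_of_nonneg_right hμz (sq_nonneg _)
    _ = ‖w‖ ^ 2 * s z + ‖w‖ ^ 2 * c z := by ring
    _ ≤ ‖w‖ * s z + ‖w‖ ^ 2 * c z := by
        have : ‖w‖ ^ 2 ≤ ‖w‖ := pow_le_of_le_one hwn.le hx.1 two_ne_zero
        linarith [mul_le_mul_of_nonneg_right this hzs]
    _ = s w + c w := by rw [hsz, hcz]

/-- By convexity, a feasible point doing at least as well as `x₀` would violate the local growth
along the segment that joins it to `x₀`. -/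
theorem IsStrongSolution.eq_zero_of_l12Norm_le (h : IsStrongSolution (objective V Φ D x₀) x₀)
    {w : EuclideanSpace ℝ (Fin n)} (hw : w ∈ LinearMap.ker Φ)
    (hle : l12Norm V (D.adjoint x₀ + D.adjoint w) ≤ l12Norm V (D.adjoint x₀)) : w = 0 := by
  obtain ⟨κ, hκ, δ, hδ, hgrow⟩ := h
  by_contra hw0
  have hwn : 0 < ‖w‖ := norm_pos_iff.mpr hw0
  set t := min 1 (δ / ‖w‖) with ht
  have ht0 : 0 < t := by positivity
  have ht1 : t ≤ 1 := min_le_left _ _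
  have htw : ‖t • w‖ ≤ δ := by
    rw [norm_smul, Real.norm_of_nonneg ht0.le, ← le_div_iff₀ hwn]
    exact min_le_right _ _
  have h1 := hgrow (x₀ + t • w) (by simpa [Metric.mem_closedBall, dist_eq_norm] using htw)
  rw [objective_self, objective_add (Submodule.smul_mem _ t hw), add_sub_cancel_left,
    ← EReal.coe_add, EReal.coe_le_coe_iff] at h1
  have hconv : l12Norm V (D.adjoint x₀ + D.adjoint (t • w)) ≤
      (1 - t) * l12Norm V (D.adjoint x₀) + t * l12Norm V (D.adjoint x₀ + D.adjoint w) := by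
    have heq : D.adjoint x₀ + D.adjoint (t • w) =
        (1 - t) • D.adjoint x₀ + t • (D.adjoint x₀ + D.adjoint w) := by
      rw [map_smul]
      module
    rw [heq]
    refine (l12Norm_add_le _ _).trans_eq ?_
    rw [l12Norm_smul, l12Norm_smul, abs_of_nonneg (sub_nonneg.mpr ht1), abs_of_pos ht0]
  have hpos : 0 < κ / 2 * ‖t • w‖ ^ 2 := by
    have : 0 < ‖t • w‖ := norm_pos_iff.mpr (smul_ne_zero ht0.ne' hw0)
    positivity
  linarith [mul_le_mul_of_nonneg_left hle ht0.le]

theorem IsStrongSolution.isUniqueSolution (h : IsStrongSolution (objective V Φ D x₀) x₀) :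
    IsUniqueSolution (objective V Φ D x₀) x₀ := by
  refine ⟨isSolution_iff.mpr fun w hw => ?_, fun x hx => ?_⟩
  · by_contra! hlt
    have h0 := h.eq_zero_of_l12Norm_le hw hlt.le
    rw [h0, map_zero, add_zero] at hlt
    exact hlt.false
  · have hle := hx x₀
    have hxf : Φ x = Φ x₀ := by
      by_contra hne
      rw [show objective V Φ D x₀ x = ⊤ from if_neg hne, objective_self] at hle
      exact (EReal.coe_lt_top _).not_ge hle
    have hw : x - x₀ ∈ LinearMap.ker Φ := by rw [LinearMap.mem_ker, map_sub, hxf, sub_self]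
    rw [← add_sub_cancel x₀ x, objective_self, objective_add hw, EReal.coe_le_coe_iff] at hle
    exact sub_eq_zero.mp (h.eq_zero_of_l12Norm_le hw hle)

end Model

end GroupSparsity

/-- Unique and strong solutions of `min ‖D^* x‖_{ℓ₁/ℓ₂}` subject to `Φ x = Φ x₀`. The first
conjunct says that the minimum that defines `ζ(e)` is attained. -/
theorem theorem5p4 {n m p q k : ℕ}
    (V : Fin q → Submodule ℝ (EuclideanSpace ℝ (Fin p)))
    (hV : GroupSparsity.IsGroupDecomposition V)
    (Φ : EuclideanSpace ℝ (Fin n) →ₗ[ℝ] EuclideanSpace ℝ (Fin m))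
    (D : EuclideanSpace ℝ (Fin p) →ₗ[ℝ] EuclideanSpace ℝ (Fin n))
    (x₀ : EuclideanSpace ℝ (Fin n))
    (M : EuclideanSpace ℝ (Fin n) →ₗ[ℝ] EuclideanSpace ℝ (Fin k))
    (hM : GroupSparsity.IsBasisMatrix M.adjoint
      (LinearMap.ker Φ ⊓ GroupSparsity.spaceE V D x₀)) :
    IsLeast (GroupSparsity.sourceValues V D M x₀) (GroupSparsity.strongSourceCoeff V D M x₀) ∧
    List.TFAE [
      GroupSparsity.IsUniqueSolution (GroupSparsity.objective V Φ D x₀) x₀,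
      GroupSparsity.IsStrongSolution (GroupSparsity.objective V Φ D x₀) x₀,
      GroupSparsity.IsSolution (GroupSparsity.objective V Φ D x₀) x₀ ∧
        LinearMap.ker Φ ⊓ GroupSparsity.spaceE V D x₀ ⊓
          LinearMap.ker (GroupSparsity.DS V D x₀).adjoint = ⊥ ∧
        GroupSparsity.strongSourceCoeff V D M x₀ < 1] := by
  refine ⟨hV.isLeast_strongSourceCoeff, ?_⟩
  tfae_have 1 → 3 := by
    intro h
    have hslope : ∀ w ∈ LinearMap.ker Φ ⊓ GroupSparsity.spaceE V D x₀, w ≠ 0 → _ :=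
      fun w hw hw0 => (h.sum_normSlope_pos hV hw hw0).trans_eq (hV.sum_normSlope_eq w)
    have hinj : LinearMap.ker Φ ⊓ GroupSparsity.spaceE V D x₀ ⊓
        LinearMap.ker (GroupSparsity.DS V D x₀).adjoint = ⊥ := by
      refine (Submodule.eq_bot_iff _).mpr fun w hw => ?_
      by_contra hw0
      -- the slopes at `w` and `-w` would be opposite numbers
      have h1 := hslope w hw.1 hw0
      have h2 := hslope (-w) (neg_mem hw.1) (neg_ne_zero.mpr hw0)
      have hker : (GroupSparsity.DS V D x₀).adjoint w = 0 := hw.2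
      rw [map_neg, hker, neg_zero, inner_neg_right, GroupSparsity.l12Norm_zero] at h2
      rw [hker, GroupSparsity.l12Norm_zero] at h1
      linarith
    exact ⟨h.1, hinj, hV.strongSourceCoeff_lt_one hM hinj hslope⟩
  tfae_have 3 → 2 := by
    rintro ⟨h, hinj, hζ⟩
    refine h.isStrongSolution hV fun w hw hw0 => ?_
    rw [hV.sum_normSlope_eq]
    exact hV.slope_pos_of_strongSourceCoeff_lt_one hM hinj hζ hw hw0
  tfae_have 2 → 1 := fun h => h.isUniqueSolution
  tfae_finish
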